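/- Let $n\ge 1$ be an integer and let $\mu$ be a finite nonnegative Borel measure on $\mathbb{R}^n$ for which the integral $\int\int \ln|x-y|\,d\mu(y)\,d\mu(x)$ exists in $[-\infty,\infty]$ (where $\ln 0=-\infty$). Let $$I(\mu)=\int\int \ln\frac{1}{|x-y|}\,d\mu(y)\,d\mu(x)\in[-\infty,\infty]$$ be its logarithmic energy, and let $\widehat{\mu}(\xi)=\int_{\mathbb{R}^n}e^{i\xi\cdot x}\,d\mu(x)$ for $\xi\in\mathbb{R}^n$ be its Fourier transform. Assume that the limit $$\lim_{\varepsilon\to 0^+}\int_{\varepsilon\le|\xi|\le 1}\bigl(|\widehat{\mu}(\xi)|^2-\mu(\mathbb{R}^n)^2\bigr)\frac{d\xi}{|\xi|^n}$$ exists as a real number. Then $I(\mu)$ is finite if and only if $|\widehat{\mu}|^2$ is integrable at infinity with respect to $d\xi/|\xi|^n$, that is, if and only if for some $R>0$ $$\int_{|\xi|\ge R}|\widehat{\mu}(\xi)|^2\,\frac{d\xi}{|\xi|^n}<\infty .$$ -/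

import Mathlib

open MeasureTheory Filter Topology
open scoped ENNReal

noncomputable section

namespace LogEnergy

/-- The extended integral `∫ f dμ = ∫ f⁺ dμ - ∫ f⁻ dμ` of an extended real valued function.
It is meaningful only when `ExtIntegralExists f μ` holds. -/
def extIntegral {α : Type*} [MeasurableSpace α] (f : α → EReal) (μ : Measure α) : EReal :=
  ((∫⁻ x, (f x).toENNReal ∂μ : ℝ≥0∞) : EReal) - ((∫⁻ x, (-f x).toENNReal ∂μ : ℝ≥0∞) : EReal)

/-- The integral `∫ f dμ` exists in `[-∞, ∞]`: `f` is measurable and at least one of the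
integrals of `f⁺` and `f⁻` is finite. -/
def ExtIntegralExists {α : Type*} [MeasurableSpace α] (f : α → EReal) (μ : Measure α) : Prop :=
  AEMeasurable f μ ∧
    ((∫⁻ x, (f x).toENNReal ∂μ) ≠ ∞ ∨ (∫⁻ x, (-f x).toENNReal ∂μ) ≠ ∞)

/-- The kernel `ln (1 / |x - y|) ∈ (-∞, ∞]`, with the value `+∞` for `x = y`. -/
def logKernel {n : ℕ} (x y : EuclideanSpace ℝ (Fin n)) : EReal :=
  ENNReal.log (ENNReal.ofReal ‖x - y‖)⁻¹

/-- The logarithmic potential `p_μ(x) = ∫ ln (1 / |x - y|) dμ(y)`. -/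
def logPotential {n : ℕ} (μ : Measure (EuclideanSpace ℝ (Fin n)))
    (x : EuclideanSpace ℝ (Fin n)) : EReal :=
  extIntegral (fun y => logKernel x y) μ

/-- The logarithmic energy `I(μ) = ∫ p_μ(x) dμ(x)` of a nonnegative measure. -/
def logEnergy {n : ℕ} (μ : Measure (EuclideanSpace ℝ (Fin n))) : EReal :=
  extIntegral (logPotential μ) μ

/-- The class `M_{0,+}(ℝⁿ)`: finite nonnegative Borel measures for which
the iterated integral `∫∫ ln |x - y| dμ(y) dμ(x)`, equivalently that of `ln (1 / |x - y|)`,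
exists in `[-∞, ∞]`: the inner integral for `μ`-almost every `x`, and then the outer one. -/
structure MemM0Plus {n : ℕ} (μ : Measure (EuclideanSpace ℝ (Fin n))) : Prop where
  finite : IsFiniteMeasure μ
  inner_exists : ∀ᵐ x ∂μ, ExtIntegralExists (fun y => logKernel x y) μ
  outer_exists : ExtIntegralExists (logPotential μ) μ

/-- The measure `dξ / |ξ|ⁿ` on `ℝⁿ`. -/
def invNormPow (n : ℕ) : Measure (EuclideanSpace ℝ (Fin n)) :=
  volume.withDensity fun ξ => ENNReal.ofReal (1 / ‖ξ‖ ^ n)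

end LogEnergy

end

/-!
Let `ν` be the image of `μ × μ` under `(x, y) ↦ x - y`. Its Fourier transform is `|μ̂|²`, its total
mass is `μ(ℝⁿ)²`, and the energy is `∫ log (1 / |z|) dν(z)`, so the question is how the two
logarithmic moments `∫ log⁺ (1 / |z|) dν` and `∫ log⁺ |z| dν` are read off from `ν̂`.

For every `t > 0` the Fourier transform of a Gaussian gives
`∫ ν̂(ξ) exp (-t|ξ|²) dξ = (π / t) ^ (n / 2) ∫ exp (-|z|² / 4t) dν(z)`, together with the same
identity for `ν(ℝⁿ) - ν̂` and `1 - exp (-|z|² / 4t)`. All these integrands are nonnegative, so both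
identities may be integrated over `t` with weight `t ^ (n / 2 - 1)` by Tonelli's theorem
(`lintegral_mul_gaussMix`); over all of `(0, ∞)` this weight turns `exp (-t|ξ|²)` into a multiple
of `|ξ|⁻ⁿ`.

* Over `t ∈ (0, 1]` the frequency weight is bounded and comparable to `|ξ|⁻ⁿ` at infinity, and the
  kernel in space is `2 log⁺ (1 / |z|) + O(1)`. Hence `∫ log⁺ (1 / |z|) dν` is finite if and only if
  `|μ̂|²` is integrable at infinity against `dξ / |ξ|ⁿ`
  (`lintegral_logInvPos_ne_top_of_tail`, `setLIntegral_tail_ne_top`).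
* Over `t ∈ (1, ∞)` the frequency weight is at most a multiple of `|ξ|⁻ⁿ` and decays like a Gaussian
  at infinity, and the kernel in space dominates a multiple of `log⁺ |z|`. The integrand in the
  limit hypothesis has constant sign, so the limit exists only if `μ(ℝⁿ)² - |μ̂|²` is absolutely
  integrable near the origin, and then `∫ log⁺ |z| dν` is finite (`lintegral_log_ne_top`).

Once `∫ log⁺ |z| dν` is finite, the negative part of the potential is integrable, and the
energy is finite exactly when `∫ log⁺ (1 / |z|) dν` is (`logEnergy_finite_iff`).
-/

namespace LogEnergy

open Real Set Module
open scoped RealInnerProductSpace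

/-! ### The law of the difference and its Fourier transform -/

section Gaussian

variable {E : Type*} [NormedAddCommGroup E] [InnerProductSpace ℝ E]
  [MeasurableSpace E] [BorelSpace E] [FiniteDimensional ℝ E]

/-- The image of `μ × μ` under `(x, y) ↦ x - y`, encoded as the convolution of `μ` with its
reflection. -/
noncomputable def diffMeasure (μ : Measure E) : Measure E := μ ∗ μ.map (fun x => -x)

instance (μ : Measure E) [IsFiniteMeasure μ] : IsFiniteMeasure (diffMeasure μ) := by
  unfold diffMeasure; infer_instance

lemma lintegral_diffMeasure (μ : Measure E) [IsFiniteMeasure μ] {f : E → ℝ≥0∞}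
    (hf : Measurable f) :
    ∫⁻ z, f z ∂(diffMeasure μ) = ∫⁻ x, ∫⁻ y, f (x - y) ∂μ ∂μ := by
  rw [diffMeasure, Measure.lintegral_conv hf]
  refine lintegral_congr fun x => ?_
  rw [lintegral_map (by fun_prop) (by fun_prop)]
  simp only [sub_eq_add_neg]

lemma charFun_diffMeasure (μ : Measure E) [IsFiniteMeasure μ] (ξ : E) :
    charFun (diffMeasure μ) ξ = ((‖charFun μ ξ‖ ^ 2 : ℝ) : ℂ) := by
  have h : charFun (μ.map (fun x => -x)) ξ = charFun μ (-ξ) := by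
    simpa using charFun_map_smul (μ := μ) (-1) ξ
  rw [diffMeasure, charFun_conv, h, charFun_neg, Complex.mul_conj, Complex.normSq_eq_norm_sq]

lemma measureReal_univ_diffMeasure (μ : Measure E) [IsFiniteMeasure μ] :
    (diffMeasure μ).real univ = μ.real univ ^ 2 := by
  have h := charFun_diffMeasure μ 0
  rw [charFun_zero, charFun_zero] at h
  rw [Complex.ofReal_inj.mp h]
  simp

/-! ### Gaussian averages of the Fourier transform -/

lemma integrable_gaussian {t : ℝ} (ht : 0 < t) :
    Integrable (fun ξ : E => rexp (-t * ‖ξ‖ ^ 2)) := by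
  have h := (GaussianFourier.integrable_cexp_neg_mul_sq_norm_add (V := E) (b := t)
    (by simpa using ht) 0 0).norm
  refine h.congr (ae_of_all _ fun ξ => ?_)
  simp only [Complex.norm_exp]
  congr 1
  norm_cast
  simp

/-- Parseval's identity between `ν` and a Gaussian: Fubini, then the Fourier transform of the
Gaussian. -/
lemma integral_charFun_mul_gaussian (ν : Measure E) [IsFiniteMeasure ν] {t : ℝ} (ht : 0 < t) :
    ∫ ξ, charFun ν ξ * (rexp (-t * ‖ξ‖ ^ 2) : ℂ) =
      (((π / t) ^ (finrank ℝ E / 2 : ℝ) * ∫ z, rexp (-‖z‖ ^ 2 / (4 * t)) ∂ν : ℝ) : ℂ) := by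
  have hint : Integrable (Function.uncurry fun (ξ z : E) =>
      Complex.exp (⟪z, ξ⟫ * Complex.I) * (rexp (-t * ‖ξ‖ ^ 2) : ℂ)) (volume.prod ν) := by
    have h := (integrable_gaussian (E := E) ht).mul_prod (integrable_const (μ := ν) (1 : ℝ))
    refine h.mono' (by fun_prop) (ae_of_all _ fun p => ?_)
    simp only [Function.uncurry, norm_mul, Complex.norm_exp_ofReal_mul_I, Complex.norm_real,
      Real.norm_eq_abs, abs_exp, one_mul, mul_one, le_refl]
  calc ∫ ξ, charFun ν ξ * (rexp (-t * ‖ξ‖ ^ 2) : ℂ)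
      = ∫ ξ, ∫ z, Complex.exp (⟪z, ξ⟫ * Complex.I) * (rexp (-t * ‖ξ‖ ^ 2) : ℂ) ∂ν := by
        refine integral_congr_ae (ae_of_all _ fun ξ => ?_)
        simp only [charFun_apply, integral_mul_const]
    _ = ∫ z, (∫ ξ, Complex.exp (⟪z, ξ⟫ * Complex.I) * (rexp (-t * ‖ξ‖ ^ 2) : ℂ)) ∂ν :=
        integral_integral_swap hint
    _ = ∫ z, (((π / t) ^ (finrank ℝ E / 2 : ℝ) * rexp (-‖z‖ ^ 2 / (4 * t)) : ℝ) : ℂ) ∂ν := by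
        refine integral_congr_ae (ae_of_all _ fun z => ?_)
        have h := GaussianFourier.integral_cexp_neg_mul_sq_norm_add (V := E) (b := t)
          (by simpa using ht) Complex.I z
        simp only
        rw [Complex.ofReal_mul, Complex.ofReal_cpow (by positivity)]
        convert h using 1
        · refine integral_congr_ae (ae_of_all _ fun ξ => ?_)
          simp only [Complex.ofReal_exp, ← Complex.exp_add]
          congr 1
          push_cast
          ring
        · push_cast
          simp
    _ = _ := by rw [integral_complex_ofReal, integral_const_mul]

variable {ν : Measure E} [IsFiniteMeasure ν] {φ : E → ℝ}

lemma integrable_mul_gaussian (hφ : ∀ ξ, charFun ν ξ = φ ξ) {t : ℝ} (ht : 0 < t) :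
    Integrable (fun ξ => φ ξ * rexp (-t * ‖ξ‖ ^ 2)) := by
  have hm : Measurable φ := by
    have : φ = fun ξ => (charFun ν ξ).re := by ext ξ; simp [hφ]
    rw [this]; fun_prop
  refine (integrable_gaussian (E := E) ht).bdd_mul (c := ν.real univ) hm.aestronglyMeasurable
    (ae_of_all _ fun ξ => ?_)
  have := norm_charFun_le (μ := ν) ξ
  rwa [hφ, Complex.norm_real] at this

lemma integral_mul_gaussian (hφ : ∀ ξ, charFun ν ξ = φ ξ) {t : ℝ} (ht : 0 < t) :
    ∫ ξ, φ ξ * rexp (-t * ‖ξ‖ ^ 2) =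
      (π / t) ^ (finrank ℝ E / 2 : ℝ) * ∫ z, rexp (-‖z‖ ^ 2 / (4 * t)) ∂ν := by
  have h := integral_charFun_mul_gaussian ν ht
  simp only [hφ, ← Complex.ofReal_mul] at h
  rw [integral_complex_ofReal] at h
  exact_mod_cast h

lemma integrable_heatKernel {t : ℝ} (ht : 0 < t) :
    Integrable (fun z => rexp (-‖z‖ ^ 2 / (4 * t))) ν := by
  refine Integrable.of_bound (by fun_prop) 1 (ae_of_all _ fun z => ?_)
  rw [Real.norm_eq_abs, abs_exp, Real.exp_le_one_iff]
  exact div_nonpos_of_nonpos_of_nonneg (by simp) (by positivity)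

lemma lintegral_mul_gaussian (hφ : ∀ ξ, charFun ν ξ = φ ξ) (h0 : ∀ ξ, 0 ≤ φ ξ) {t : ℝ}
    (ht : 0 < t) :
    ∫⁻ ξ, ENNReal.ofReal (φ ξ) * ENNReal.ofReal (rexp (-t * ‖ξ‖ ^ 2)) =
      ENNReal.ofReal ((π / t) ^ (finrank ℝ E / 2 : ℝ)) *
        ∫⁻ z, ENNReal.ofReal (rexp (-‖z‖ ^ 2 / (4 * t))) ∂ν := by
  simp_rw [← ENNReal.ofReal_mul (h0 _)]
  rw [← ofReal_integral_eq_lintegral_ofReal (integrable_mul_gaussian hφ ht)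
      (ae_of_all _ fun ξ => mul_nonneg (h0 ξ) (exp_nonneg _)),
    ← ofReal_integral_eq_lintegral_ofReal (integrable_heatKernel ht)
      (ae_of_all _ fun z => exp_nonneg _), integral_mul_gaussian hφ ht,
    ENNReal.ofReal_mul (by positivity)]

lemma lintegral_sub_mul_gaussian (hφ : ∀ ξ, charFun ν ξ = φ ξ) (h0 : ∀ ξ, φ ξ ≤ ν.real univ)
    {t : ℝ} (ht : 0 < t) :
    ∫⁻ ξ, ENNReal.ofReal (ν.real univ - φ ξ) * ENNReal.ofReal (rexp (-t * ‖ξ‖ ^ 2)) =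
      ENNReal.ofReal ((π / t) ^ (finrank ℝ E / 2 : ℝ)) *
        ∫⁻ z, ENNReal.ofReal (1 - rexp (-‖z‖ ^ 2 / (4 * t))) ∂ν := by
  simp_rw [← ENNReal.ofReal_mul (sub_nonneg.2 (h0 _))]
  have h1 := (integrable_gaussian (E := E) ht).const_mul (ν.real univ)
  have h2 := integrable_mul_gaussian hφ ht
  rw [← ofReal_integral_eq_lintegral_ofReal
      ((h1.sub h2).congr (ae_of_all _ fun ξ => (sub_mul _ _ _).symm))
      (ae_of_all _ fun ξ => mul_nonneg (sub_nonneg.2 (h0 ξ)) (exp_nonneg _)),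
    ← ofReal_integral_eq_lintegral_ofReal (f := fun z => 1 - rexp (-‖z‖ ^ 2 / (4 * t)))
      ((integrable_const 1).sub (integrable_heatKernel ht)) (ae_of_all _ fun z => ?_),
    ← ENNReal.ofReal_mul (by positivity)]
  · congr 1
    simp only [sub_mul]
    rw [integral_sub h1 h2, integral_const_mul, integral_mul_gaussian hφ ht,
      GaussianFourier.integral_rexp_neg_mul_sq_norm ht,
      integral_sub (integrable_const 1) (integrable_heatKernel ht)]
    simp only [integral_const, smul_eq_mul, mul_one]
    ring
  · have : rexp (-‖z‖ ^ 2 / (4 * t)) ≤ 1 := by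
      rw [Real.exp_le_one_iff]
      exact div_nonpos_of_nonpos_of_nonneg (by simp) (by positivity)
    simpa using this

/-! ### Mixtures of Gaussians -/

/-- The radial weight `∫_T t ^ (d / 2 - 1) exp (-t r²) dt`. For `T = (0, ∞)` it is a multiple of
`r⁻ᵈ`; the parts `T = (0, 1]` and `T = (1, ∞)` carry its behaviour for large and small `r`. -/
noncomputable def gaussMix (T : Set ℝ) (d r : ℝ) : ℝ≥0∞ :=
  ∫⁻ t in T, ENNReal.ofReal (t ^ (d / 2 - 1)) * ENNReal.ofReal (rexp (-t * r ^ 2))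

/-- An identity between Gaussian averages, integrated over `t ∈ T` with weight `t ^ (d / 2 - 1)`.
This weight cancels `t ^ (-d / 2)` up to the scale invariant `dt / t`. -/
lemma lintegral_mul_gaussMix {T : Set ℝ} (hT : MeasurableSet T) (hT0 : T ⊆ Ioi 0)
    {φ : E → ℝ} (hφ : Measurable φ) {ψ : ℝ → E → ℝ} (hψ : Measurable (Function.uncurry ψ))
    (h : ∀ t, 0 < t → ∫⁻ ξ, ENNReal.ofReal (φ ξ) * ENNReal.ofReal (rexp (-t * ‖ξ‖ ^ 2)) =
      ENNReal.ofReal ((π / t) ^ (finrank ℝ E / 2 : ℝ)) * ∫⁻ z, ENNReal.ofReal (ψ t z) ∂ν) :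
    ∫⁻ ξ, ENNReal.ofReal (φ ξ) * gaussMix T (finrank ℝ E) ‖ξ‖ =
      ENNReal.ofReal (π ^ (finrank ℝ E / 2 : ℝ)) *
        ∫⁻ z, (∫⁻ t in T, ENNReal.ofReal t⁻¹ * ENNReal.ofReal (ψ t z)) ∂ν := by
  set d : ℝ := (finrank ℝ E : ℝ)
  have hψ' : Measurable fun p : E × ℝ => ψ p.2 p.1 := hψ.comp measurable_swap
  calc ∫⁻ ξ, ENNReal.ofReal (φ ξ) * gaussMix T d ‖ξ‖
      = ∫⁻ ξ, ∫⁻ t in T, ENNReal.ofReal (φ ξ) *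
          (ENNReal.ofReal (t ^ (d / 2 - 1)) * ENNReal.ofReal (rexp (-t * ‖ξ‖ ^ 2))) := by
        refine lintegral_congr fun ξ => ?_
        rw [gaussMix, lintegral_const_mul _ (by fun_prop)]
    _ = ∫⁻ t in T, ∫⁻ ξ : E, ENNReal.ofReal (φ ξ) *
          (ENNReal.ofReal (t ^ (d / 2 - 1)) * ENNReal.ofReal (rexp (-t * ‖ξ‖ ^ 2))) :=
        lintegral_lintegral_swap (by fun_prop)
    _ = ∫⁻ t in T, ENNReal.ofReal (π ^ (d / 2)) *
          ∫⁻ z, ENNReal.ofReal t⁻¹ * ENNReal.ofReal (ψ t z) ∂ν := by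
        refine setLIntegral_congr_fun hT fun t ht => ?_
        have ht0 : 0 < t := hT0 ht
        have hψt : Measurable (ψ t) := hψ.of_uncurry_left
        simp only [mul_left_comm (ENNReal.ofReal (φ _))]
        rw [lintegral_const_mul _ (by fun_prop), h t ht0, lintegral_const_mul _ (by fun_prop),
          ← mul_assoc, ← mul_assoc, ← ENNReal.ofReal_mul (by positivity),
          ← ENNReal.ofReal_mul (by positivity)]
        congr 2
        rw [div_rpow pi_nonneg ht0.le, rpow_sub_one ht0.ne']
        have := (rpow_pos_of_pos ht0 (d / 2)).ne'
        field_simp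
    _ = ENNReal.ofReal (π ^ (d / 2)) *
          ∫⁻ t in T, ∫⁻ z, ENNReal.ofReal t⁻¹ * ENNReal.ofReal (ψ t z) ∂ν :=
        lintegral_const_mul' _ _ ENNReal.ofReal_ne_top
    _ = _ := by
        congr 1
        exact lintegral_lintegral_swap (by fun_prop)

end Gaussian

/-! ### The weights in frequency space -/

lemma one_div_sq_rpow_half {r : ℝ} (hr : 0 < r) (d : ℕ) :
    (1 / r ^ 2) ^ (d / 2 : ℝ) = 1 / r ^ d := by
  rw [div_rpow zero_le_one (by positivity), one_rpow, ← rpow_natCast r 2, ← rpow_mul hr.le]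
  congr 1
  rw [← rpow_natCast r d]
  congr 1
  push_cast
  ring

lemma gaussMix_le_inv_pow {T : Set ℝ} (hT : T ⊆ Ioi 0) {d : ℕ} (hd : 0 < d) {r : ℝ}
    (hr : 0 < r) :
    gaussMix T d r ≤ ENNReal.ofReal (Gamma (d / 2)) * ENNReal.ofReal (1 / r ^ d) := by
  have hd' : (0 : ℝ) < d / 2 := by positivity
  have hI := integral_rpow_mul_exp_neg_mul_Ioi hd' (show 0 < r ^ 2 by positivity)
  have hpos : 0 < (1 / r ^ 2) ^ (d / 2 : ℝ) * Gamma (d / 2) :=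
    mul_pos (by positivity) (Gamma_pos_of_pos hd')
  have hint := not_imp_comm.1 integral_undef (hI.trans_ne hpos.ne')
  calc gaussMix T d r
      ≤ ∫⁻ t in Ioi 0, ENNReal.ofReal (t ^ (d / 2 - 1 : ℝ)) *
          ENNReal.ofReal (rexp (-t * r ^ 2)) := lintegral_mono_set hT
    _ = ∫⁻ t in Ioi 0, ENNReal.ofReal (t ^ (d / 2 - 1 : ℝ) * rexp (-(r ^ 2 * t))) := by
        refine setLIntegral_congr_fun measurableSet_Ioi fun t ht => ?_
        have ht0 : 0 < t := ht
        rw [← ENNReal.ofReal_mul (by positivity)]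
        congr 3
        ring
    _ = ENNReal.ofReal ((1 / r ^ 2) ^ (d / 2 : ℝ) * Gamma (d / 2)) := by
        rw [← hI, ofReal_integral_eq_lintegral_ofReal hint]
        refine (ae_restrict_iff' measurableSet_Ioi).2 (ae_of_all _ fun t ht => ?_)
        have ht0 : 0 < t := ht
        simp only [Pi.zero_apply]
        positivity
    _ = _ := by
        rw [one_div_sq_rpow_half hr, mul_comm,
          ENNReal.ofReal_mul (Gamma_pos_of_pos hd').le]

lemma gaussMix_Ioc_le {d : ℕ} (hd : 0 < d) (r : ℝ) :
    gaussMix (Ioc 0 1) d r ≤ ENNReal.ofReal (rexp 1) * ENNReal.ofReal (Gamma (d / 2)) := by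
  calc gaussMix (Ioc 0 1) d r
      ≤ ∫⁻ t in Ioc 0 1, ENNReal.ofReal (rexp 1) * (ENNReal.ofReal (t ^ (d / 2 - 1 : ℝ)) *
          ENNReal.ofReal (rexp (-t * 1 ^ 2))) := by
        refine setLIntegral_mono' measurableSet_Ioc fun t ht => ?_
        rw [mul_left_comm, ← ENNReal.ofReal_mul (exp_nonneg _), ← Real.exp_add]
        gcongr
        -- `-t r² ≤ 0 ≤ 1 - t`
        nlinarith [ht.1, ht.2, mul_nonneg ht.1.le (sq_nonneg r)]
    _ = ENNReal.ofReal (rexp 1) * gaussMix (Ioc 0 1) d 1 :=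
        lintegral_const_mul' _ _ ENNReal.ofReal_ne_top
    _ ≤ _ := by
        gcongr
        simpa using gaussMix_le_inv_pow Ioc_subset_Ioi_self hd one_pos

lemma inv_pow_le_gaussMix_Ioc {d : ℕ} (hd : 0 < d) {r : ℝ} (hr : 1 ≤ r) :
    ENNReal.ofReal (rexp (-1) * (2 / d)) * ENNReal.ofReal (1 / r ^ d) ≤
      gaussMix (Ioc 0 1) d r := by
  have hr0 : 0 < r := by linarith
  have hd' : (0 : ℝ) < d / 2 := by positivity
  have ha : 0 < 1 / r ^ 2 := by positivity
  have ha1 : 1 / r ^ 2 ≤ 1 := by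
    rw [div_le_one (by positivity)]
    nlinarith
  have hI : ∫ t in Ioc 0 (1 / r ^ 2), t ^ (d / 2 - 1 : ℝ) = 2 / d * (1 / r ^ d) := by
    rw [← intervalIntegral.integral_of_le ha.le, integral_rpow (Or.inl (by linarith)),
      sub_add_cancel, one_div_sq_rpow_half hr0, zero_rpow hd'.ne', sub_zero]
    field_simp
  have hint : IntegrableOn (fun t : ℝ => t ^ (d / 2 - 1 : ℝ)) (Ioc 0 (1 / r ^ 2)) :=
    (intervalIntegrable_iff_integrableOn_Ioc_of_le ha.le).1
      (intervalIntegral.intervalIntegrable_rpow' (by linarith))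
  calc ENNReal.ofReal (rexp (-1) * (2 / d)) * ENNReal.ofReal (1 / r ^ d)
      = ENNReal.ofReal (rexp (-1)) * ∫⁻ t in Ioc 0 (1 / r ^ 2),
          ENNReal.ofReal (t ^ (d / 2 - 1 : ℝ)) := by
        rw [← ofReal_integral_eq_lintegral_ofReal hint, hI,
          ← ENNReal.ofReal_mul (by positivity), ← ENNReal.ofReal_mul (by positivity), mul_assoc]
        refine (ae_restrict_iff' measurableSet_Ioc).2 (ae_of_all _ fun t ht => ?_)
        exact rpow_nonneg ht.1.le _
    _ = ∫⁻ t in Ioc 0 (1 / r ^ 2), ENNReal.ofReal (rexp (-1)) *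
          ENNReal.ofReal (t ^ (d / 2 - 1 : ℝ)) :=
        (lintegral_const_mul' _ _ ENNReal.ofReal_ne_top).symm
    _ ≤ ∫⁻ t in Ioc 0 (1 / r ^ 2), ENNReal.ofReal (t ^ (d / 2 - 1 : ℝ)) *
          ENNReal.ofReal (rexp (-t * r ^ 2)) := by
        refine setLIntegral_mono' measurableSet_Ioc fun t ht => ?_
        rw [mul_comm]
        gcongr
        have := (le_div_iff₀ (by positivity)).1 ht.2
        linarith
    _ ≤ gaussMix (Ioc 0 1) d r := lintegral_mono_set (Ioc_subset_Ioc_right ha1)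

lemma gaussMix_Ioi_le {d : ℕ} {r : ℝ} (hr : 1 ≤ r) :
    gaussMix (Ioi 1) d r ≤
      ENNReal.ofReal (rexp (-(1 / 2) * r ^ 2)) * gaussMix (Ioi 1) d √(1 / 2) := by
  rw [gaussMix, gaussMix, ← lintegral_const_mul' _ _ ENNReal.ofReal_ne_top]
  refine setLIntegral_mono' measurableSet_Ioi fun t ht => ?_
  rw [mul_left_comm, ← ENNReal.ofReal_mul (exp_nonneg _), ← Real.exp_add,
    sq_sqrt (by norm_num)]
  gcongr
  have ht1 : (1 : ℝ) < t := ht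
  -- `t s ≥ (t + s) / 2` for `t, s ≥ 1`.
  nlinarith [mul_nonneg (sub_nonneg.2 ht1.le) (show 0 ≤ r ^ 2 - 1 by nlinarith)]

/-! ### The logarithmic kernels -/

/-- The positive part of `log (1 / r)`, equal to `∞` at `r = 0`. -/
noncomputable def logInvPos (r : ℝ) : ℝ≥0∞ := (ENNReal.log (ENNReal.ofReal r)⁻¹).toENNReal

lemma logInvPos_of_pos {r : ℝ} (hr : 0 < r) : logInvPos r = ENNReal.ofReal (-log r) := by
  rw [logInvPos, ENNReal.log_inv, ENNReal.log_ofReal_of_pos hr, ← EReal.coe_neg,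
    EReal.real_coe_toENNReal]

@[fun_prop]
lemma measurable_logInvPos : Measurable logInvPos := by
  unfold logInvPos
  exact (ENNReal.measurable_log.comp (by fun_prop)).ereal_toENNReal

/-- At `r = 0` both sides vanish, the right one because `Real.log 0 = 0`. -/
lemma toENNReal_neg_log_inv {r : ℝ} (hr : 0 ≤ r) :
    (-ENNReal.log (ENNReal.ofReal r)⁻¹).toENNReal = ENNReal.ofReal (log r) := by
  rcases hr.eq_or_lt with rfl | hr
  · simp
  · rw [ENNReal.log_inv, neg_neg, ENNReal.log_ofReal_of_pos hr, EReal.real_coe_toENNReal]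

/-- The kernel `∫₀¹ exp (-r² / 4t) dt / t`, which is `2 log⁺ (1 / r) + O(1)`. -/
noncomputable def nearKernel (r : ℝ) : ℝ≥0∞ :=
  ∫⁻ t in Ioc 0 1, ENNReal.ofReal t⁻¹ * ENNReal.ofReal (rexp (-r ^ 2 / (4 * t)))

/-- The kernel `∫₁^∞ (1 - exp (-r² / 4t)) dt / t`, which dominates a multiple of `log⁺ r`. -/
noncomputable def farKernel (r : ℝ) : ℝ≥0∞ :=
  ∫⁻ t in Ioi 1, ENNReal.ofReal t⁻¹ * ENNReal.ofReal (1 - rexp (-r ^ 2 / (4 * t)))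

lemma setLIntegral_ofReal_inv {a b : ℝ} (ha : 0 < a) (hab : a ≤ b) :
    ∫⁻ t in Ioc a b, ENNReal.ofReal t⁻¹ = ENNReal.ofReal (log (b / a)) := by
  have hb : 0 < b := ha.trans_le hab
  have hint : IntegrableOn (fun t : ℝ => t⁻¹) (Ioc a b) := by
    refine (intervalIntegrable_iff_integrableOn_Ioc_of_le hab).1 ?_
    refine intervalIntegral.intervalIntegrable_inv (fun x hx => ?_) continuousOn_id
    rw [uIcc_of_le hab] at hx
    exact (ha.trans_le hx.1).ne'
  rw [← ofReal_integral_eq_lintegral_ofReal hint, ← intervalIntegral.integral_of_le hab,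
    integral_inv_of_pos ha hb]
  refine (ae_restrict_iff' measurableSet_Ioc).2 (ae_of_all _ fun t ht => ?_)
  exact inv_nonneg.2 (ha.trans ht.1).le

lemma nearKernel_zero : nearKernel 0 = ∞ := by
  refine ENNReal.eq_top_of_forall_nnreal_le fun c => ?_
  calc (c : ℝ≥0∞) = ENNReal.ofReal (log (1 / rexp (-c))) := by simp
    _ = ∫⁻ t in Ioc (rexp (-c)) 1, ENNReal.ofReal t⁻¹ :=
        (setLIntegral_ofReal_inv (exp_pos _) (by simp)).symm
    _ ≤ ∫⁻ t in Ioc 0 1, ENNReal.ofReal t⁻¹ :=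
        lintegral_mono_set (Ioc_subset_Ioc_left (exp_nonneg _))
    _ = nearKernel 0 := by simp [nearKernel]

lemma logInvPos_le_nearKernel {r : ℝ} (hr : 0 ≤ r) :
    ENNReal.ofReal (rexp (-(1 / 4))) * logInvPos r ≤ nearKernel r := by
  rcases hr.eq_or_lt with rfl | hr
  · simp [nearKernel_zero]
  rw [logInvPos_of_pos hr]
  rcases le_or_gt 1 r with h1 | h1
  · rw [ENNReal.ofReal_of_nonpos (neg_nonpos.2 (log_nonneg h1)), mul_zero]
    exact zero_le
  have hlog := log_neg hr h1
  have hr2 : r ^ 2 ≤ 1 := by nlinarith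
  calc ENNReal.ofReal (rexp (-(1 / 4))) * ENNReal.ofReal (-log r)
      ≤ ENNReal.ofReal (rexp (-(1 / 4))) * ENNReal.ofReal (log (1 / r ^ 2)) := by
        gcongr
        rw [one_div, log_inv, log_pow]
        push_cast
        linarith
    _ = ∫⁻ t in Ioc (r ^ 2) 1, ENNReal.ofReal (rexp (-(1 / 4))) * ENNReal.ofReal t⁻¹ := by
        rw [lintegral_const_mul' _ _ ENNReal.ofReal_ne_top,
          setLIntegral_ofReal_inv (by positivity) hr2]
    _ ≤ ∫⁻ t in Ioc (r ^ 2) 1, ENNReal.ofReal t⁻¹ *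
          ENNReal.ofReal (rexp (-r ^ 2 / (4 * t))) := by
        refine setLIntegral_mono' measurableSet_Ioc fun t ht => ?_
        rw [mul_comm]
        have ht0 : 0 < t := lt_trans (by positivity) ht.1
        gcongr
        rw [neg_div, neg_le_neg_iff, div_le_div_iff₀ (by positivity) (by norm_num)]
        linarith [ht.1]
    _ ≤ nearKernel r := lintegral_mono_set (Ioc_subset_Ioc_left (by positivity))

lemma nearKernel_le {r : ℝ} (hr : 0 ≤ r) : nearKernel r ≤ 4 + 2 * logInvPos r := by
  rcases hr.eq_or_lt with rfl | hr
  · simp [logInvPos, ENNReal.mul_top]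
  have hr2 : 0 < r ^ 2 := by positivity
  -- Up to `t = r²` the exponential is at most `4t / r²`; beyond, it is at most `1`.
  have hsub : Ioc (0 : ℝ) 1 ⊆ Ioc 0 (r ^ 2) ∪ Ioc (r ^ 2) 1 := fun t ht =>
    (le_or_gt t (r ^ 2)).imp (fun h => ⟨ht.1, h⟩) (fun h => ⟨h, ht.2⟩)
  refine (lintegral_mono_set hsub).trans ((lintegral_union_le _ _ _).trans (add_le_add ?_ ?_))
  · calc ∫⁻ t in Ioc 0 (r ^ 2), ENNReal.ofReal t⁻¹ * ENNReal.ofReal (rexp (-r ^ 2 / (4 * t)))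
        ≤ ∫⁻ _ in Ioc 0 (r ^ 2), ENNReal.ofReal (4 / r ^ 2) := by
          refine setLIntegral_mono' measurableSet_Ioc fun t ht => ?_
          have ht0 : 0 < t := ht.1
          rw [← ENNReal.ofReal_mul (by positivity)]
          refine ENNReal.ofReal_le_ofReal ?_
          have hu : 0 < r ^ 2 / (4 * t) := by positivity
          have he : rexp (-r ^ 2 / (4 * t)) ≤ (r ^ 2 / (4 * t))⁻¹ := by
            rw [neg_div, Real.exp_neg]
            exact inv_anti₀ hu (by linarith [add_one_le_exp (r ^ 2 / (4 * t))])
          calc t⁻¹ * rexp (-r ^ 2 / (4 * t)) ≤ t⁻¹ * (r ^ 2 / (4 * t))⁻¹ := by gcongr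
            _ = 4 / r ^ 2 := by field_simp
      _ = 4 := by
          rw [setLIntegral_const, Real.volume_Ioc, ← ENNReal.ofReal_mul (by positivity),
            sub_zero, div_mul_cancel₀ _ hr2.ne']
          norm_num
  · rcases le_or_gt 1 (r ^ 2) with h1 | h1
    · simp [Ioc_eq_empty_of_le h1]
    calc ∫⁻ t in Ioc (r ^ 2) 1, ENNReal.ofReal t⁻¹ * ENNReal.ofReal (rexp (-r ^ 2 / (4 * t)))
        ≤ ∫⁻ t in Ioc (r ^ 2) 1, ENNReal.ofReal t⁻¹ := by
          refine setLIntegral_mono' measurableSet_Ioc fun t ht => ?_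
          have ht0 : 0 < t := hr2.trans ht.1
          refine mul_le_of_le_one_right' ?_
          rw [ENNReal.ofReal_le_one, Real.exp_le_one_iff, neg_div, neg_nonpos]
          positivity
      _ = 2 * logInvPos r := by
          rw [setLIntegral_ofReal_inv hr2 h1.le, logInvPos_of_pos hr, one_div, log_inv, log_pow,
            ← ENNReal.ofReal_ofNat, ← ENNReal.ofReal_mul (by norm_num)]
          congr 1
          push_cast
          ring

lemma ofReal_log_le_farKernel {r : ℝ} (hr : 0 ≤ r) :
    ENNReal.ofReal (1 - rexp (-(1 / 4))) * ENNReal.ofReal (log r) ≤ farKernel r := by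
  rcases le_or_gt r 1 with h1 | h1
  · rw [ENNReal.ofReal_of_nonpos (log_nonpos hr h1), mul_zero]
    exact zero_le
  have hlog := log_pos h1
  have hr2 : 1 ≤ r ^ 2 := by nlinarith
  calc ENNReal.ofReal (1 - rexp (-(1 / 4))) * ENNReal.ofReal (log r)
      ≤ ENNReal.ofReal (1 - rexp (-(1 / 4))) * ENNReal.ofReal (log (r ^ 2 / 1)) := by
        gcongr
        rw [div_one]
        nlinarith
    _ = ∫⁻ t in Ioc 1 (r ^ 2), ENNReal.ofReal (1 - rexp (-(1 / 4))) * ENNReal.ofReal t⁻¹ := by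
        rw [lintegral_const_mul' _ _ ENNReal.ofReal_ne_top,
          setLIntegral_ofReal_inv one_pos hr2]
    _ ≤ ∫⁻ t in Ioc 1 (r ^ 2), ENNReal.ofReal t⁻¹ *
          ENNReal.ofReal (1 - rexp (-r ^ 2 / (4 * t))) := by
        refine setLIntegral_mono' measurableSet_Ioc fun t ht => ?_
        rw [mul_comm]
        have ht0 : 0 < t := lt_trans one_pos ht.1
        gcongr
        rw [neg_div, neg_le_neg_iff, div_le_div_iff₀ (by norm_num) (by positivity)]
        linarith [ht.2]
    _ ≤ farKernel r := lintegral_mono_set Ioc_subset_Ioi_self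

/-! ### Logarithmic moments in terms of the Fourier transform -/

lemma norm_charFun_sq_le {E : Type*} [NormedAddCommGroup E] [InnerProductSpace ℝ E]
    [MeasurableSpace E] (μ : Measure E) [IsFiniteMeasure μ] (ξ : E) :
    ‖charFun μ ξ‖ ^ 2 ≤ μ.real univ ^ 2 :=
  pow_le_pow_left₀ (norm_nonneg _) (norm_charFun_le ξ) 2

section Moments

variable {E : Type*} [NormedAddCommGroup E] [InnerProductSpace ℝ E]
  [MeasurableSpace E] [BorelSpace E] [FiniteDimensional ℝ E]

lemma lintegral_norm_charFun_sq_mul_gaussMix (μ : Measure E) [IsFiniteMeasure μ] :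
    ∫⁻ ξ, ENNReal.ofReal (‖charFun μ ξ‖ ^ 2) * gaussMix (Ioc 0 1) (finrank ℝ E) ‖ξ‖ =
      ENNReal.ofReal (π ^ (finrank ℝ E / 2 : ℝ)) *
        ∫⁻ z, nearKernel ‖z‖ ∂(diffMeasure μ) :=
  lintegral_mul_gaussMix (ν := diffMeasure μ) measurableSet_Ioc Ioc_subset_Ioi_self
    (by fun_prop) (ψ := fun t z => rexp (-‖z‖ ^ 2 / (4 * t))) (by fun_prop)
    fun _ ht => lintegral_mul_gaussian (charFun_diffMeasure μ) (fun _ => by positivity) ht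

lemma lintegral_sub_norm_charFun_sq_mul_gaussMix (μ : Measure E) [IsFiniteMeasure μ] :
    ∫⁻ ξ, ENNReal.ofReal (μ.real univ ^ 2 - ‖charFun μ ξ‖ ^ 2) *
        gaussMix (Ioi 1) (finrank ℝ E) ‖ξ‖ =
      ENNReal.ofReal (π ^ (finrank ℝ E / 2 : ℝ)) *
        ∫⁻ z, farKernel ‖z‖ ∂(diffMeasure μ) := by
  refine lintegral_mul_gaussMix (ν := diffMeasure μ) measurableSet_Ioi
    (Ioi_subset_Ioi zero_le_one) (by fun_prop)
    (ψ := fun t z => 1 - rexp (-‖z‖ ^ 2 / (4 * t))) (by fun_prop) fun t ht => ?_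
  have h := lintegral_sub_mul_gaussian (charFun_diffMeasure μ)
    (fun ξ => (norm_charFun_sq_le μ ξ).trans_eq (measureReal_univ_diffMeasure μ).symm) ht
  rwa [measureReal_univ_diffMeasure] at h

/-- The kernel `nearKernel` lies between a multiple of `logInvPos` and `4 + 2 * logInvPos`, and the
difference measure is finite. -/
lemma lintegral_logInvPos_ne_top_iff (μ : Measure E) [IsFiniteMeasure μ] :
    ∫⁻ z, logInvPos ‖z‖ ∂(diffMeasure μ) ≠ ∞ ↔
      ∫⁻ ξ, ENNReal.ofReal (‖charFun μ ξ‖ ^ 2) *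
        gaussMix (Ioc 0 1) (finrank ℝ E) ‖ξ‖ ≠ ∞ := by
  rw [lintegral_norm_charFun_sq_mul_gaussMix]
  constructor
  · intro h
    refine ENNReal.mul_ne_top ENNReal.ofReal_ne_top ?_
    refine ne_top_of_le_ne_top ?_ (lintegral_mono fun z => nearKernel_le (norm_nonneg z))
    rw [lintegral_add_left (by fun_prop), lintegral_const_mul _ (by fun_prop)]
    simp [ENNReal.mul_eq_top, h]
  · intro h h'
    have hc : ENNReal.ofReal (rexp (-(1 / 4))) ≠ 0 := by simpa using exp_pos _
    have h2 : ∫⁻ z, nearKernel ‖z‖ ∂(diffMeasure μ) = ∞ := by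
      rw [← top_le_iff]
      calc ∞ = ∫⁻ z, ENNReal.ofReal (rexp (-(1 / 4))) * logInvPos ‖z‖ ∂(diffMeasure μ) := by
            rw [lintegral_const_mul _ (by fun_prop), h', ENNReal.mul_top hc]
        _ ≤ _ := lintegral_mono fun z => logInvPos_le_nearKernel (norm_nonneg z)
    refine h ?_
    rw [h2, ENNReal.mul_top]
    simpa using rpow_pos_of_pos pi_pos _

/-- The weight `gaussMix (Ioc 0 1)` is at most a multiple of `|ξ|⁻ᵈ`, which is used on `s`, and is
bounded, which is used on the bounded complement of `s`. -/
lemma lintegral_logInvPos_ne_top_of_tail (μ : Measure E) [IsFiniteMeasure μ]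
    (hd : 0 < finrank ℝ E) {s : Set E} (hs : Bornology.IsBounded sᶜ)
    (h : ∫⁻ ξ in s, ENNReal.ofReal (‖charFun μ ξ‖ ^ 2) *
      ENNReal.ofReal (1 / ‖ξ‖ ^ finrank ℝ E) ≠ ∞) :
    ∫⁻ z, logInvPos ‖z‖ ∂(diffMeasure μ) ≠ ∞ := by
  have : Nontrivial E := nontrivial_of_finrank_pos hd
  rw [lintegral_logInvPos_ne_top_iff, ← setLIntegral_univ, ← union_compl_self s]
  refine ne_top_of_le_ne_top (ENNReal.add_ne_top.2 ⟨?_, ?_⟩) (lintegral_union_le _ _ _)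
  · refine ne_top_of_le_ne_top (ENNReal.mul_ne_top (a := ENNReal.ofReal
      (Gamma (finrank ℝ E / 2))) ENNReal.ofReal_ne_top h) ?_
    rw [← lintegral_const_mul' _ _ ENNReal.ofReal_ne_top]
    refine lintegral_mono_ae (ae_restrict_of_ae ?_)
    -- The origin is excluded because there `1 / ‖ξ‖ ^ d` takes the value `0`.
    filter_upwards [Measure.ae_ne volume (0 : E)] with ξ hξ
    rw [mul_left_comm]
    gcongr
    exact gaussMix_le_inv_pow Ioc_subset_Ioi_self hd (norm_pos_iff.2 hξ)
  · have hbd : ∀ ξ : E, ENNReal.ofReal (‖charFun μ ξ‖ ^ 2) *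
        gaussMix (Ioc 0 1) (finrank ℝ E) ‖ξ‖ ≤ ENNReal.ofReal (μ.real univ ^ 2) *
          (ENNReal.ofReal (rexp 1) * ENNReal.ofReal (Gamma (finrank ℝ E / 2))) := fun ξ => by
      gcongr
      · exact norm_charFun_le ξ
      · exact gaussMix_Ioc_le hd _
    refine ne_top_of_le_ne_top ?_ (lintegral_mono hbd)
    rw [setLIntegral_const]
    exact ENNReal.mul_ne_top (by finiteness) hs.measure_lt_top.ne

lemma setLIntegral_tail_ne_top (μ : Measure E) [IsFiniteMeasure μ]
    (hd : 0 < finrank ℝ E) (h : ∫⁻ z, logInvPos ‖z‖ ∂(diffMeasure μ) ≠ ∞) :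
    ∫⁻ ξ in {ξ : E | 1 ≤ ‖ξ‖}, ENNReal.ofReal (‖charFun μ ξ‖ ^ 2) *
      ENNReal.ofReal (1 / ‖ξ‖ ^ finrank ℝ E) ≠ ∞ := by
  have hm : MeasurableSet {ξ : E | 1 ≤ ‖ξ‖} := measurableSet_le (by fun_prop) (by fun_prop)
  rw [lintegral_logInvPos_ne_top_iff] at h
  intro h'
  refine h (top_le_iff.1 ?_)
  have hc : ENNReal.ofReal (rexp (-1) * (2 / (finrank ℝ E : ℝ))) ≠ 0 := by
    rw [Ne, ENNReal.ofReal_eq_zero, not_le]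
    positivity
  rw [← ENNReal.mul_top hc, ← h', ← lintegral_const_mul' _ _ ENNReal.ofReal_ne_top]
  refine (setLIntegral_mono' hm fun ξ hξ => ?_).trans (setLIntegral_le_lintegral _ _)
  rw [mul_left_comm]
  gcongr
  exact inv_pow_le_gaussMix_Ioc hd hξ

/-- The weight `gaussMix (Ioi 1)` is at most a multiple of `|ξ|⁻ᵈ`, which is used on the unit ball,
and of a Gaussian, which is used outside of it, where `μ(E)² - |μ̂|²` is merely bounded. -/
lemma lintegral_log_ne_top (μ : Measure E) [IsFiniteMeasure μ] (hd : 0 < finrank ℝ E)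
    (h : ∫⁻ ξ in {ξ : E | 0 < ‖ξ‖ ∧ ‖ξ‖ ≤ 1},
      ENNReal.ofReal (μ.real univ ^ 2 - ‖charFun μ ξ‖ ^ 2) *
        ENNReal.ofReal (1 / ‖ξ‖ ^ finrank ℝ E) ≠ ∞) :
    ∫⁻ z, ENNReal.ofReal (log ‖z‖) ∂(diffMeasure μ) ≠ ∞ := by
  have : Nontrivial E := nontrivial_of_finrank_pos hd
  have hm : MeasurableSet {ξ : E | 0 < ‖ξ‖ ∧ ‖ξ‖ ≤ 1} :=
    measurable_norm measurableSet_Ioc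
  have hm' : MeasurableSet {ξ : E | 1 ≤ ‖ξ‖} := measurableSet_le (by fun_prop) (by fun_prop)
  have hfar : ∫⁻ ξ, ENNReal.ofReal (μ.real univ ^ 2 - ‖charFun μ ξ‖ ^ 2) *
      gaussMix (Ioi 1) (finrank ℝ E) ‖ξ‖ ≠ ∞ := by
    rw [← lintegral_add_compl _ (measurableSet_singleton (0 : E)),
      setLIntegral_measure_zero _ _ (measure_singleton _), zero_add]
    have hsub : ({0}ᶜ : Set E) ⊆ {ξ | 0 < ‖ξ‖ ∧ ‖ξ‖ ≤ 1} ∪ {ξ | 1 ≤ ‖ξ‖} := fun ξ hξ =>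
      (le_total ‖ξ‖ 1).imp (fun h => ⟨norm_pos_iff.2 hξ, h⟩) id
    refine ne_top_of_le_ne_top (ENNReal.add_ne_top.2 ⟨?_, ?_⟩)
      ((lintegral_mono_set hsub).trans (lintegral_union_le _ _ _))
    · refine ne_top_of_le_ne_top (ENNReal.mul_ne_top (a := ENNReal.ofReal
        (Gamma (finrank ℝ E / 2))) ENNReal.ofReal_ne_top h) ?_
      rw [← lintegral_const_mul' _ _ ENNReal.ofReal_ne_top]
      refine setLIntegral_mono' hm fun ξ hξ => ?_
      rw [mul_left_comm]
      gcongr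
      exact gaussMix_le_inv_pow (Ioi_subset_Ioi zero_le_one) hd hξ.1
    · set K : ℝ≥0∞ := gaussMix (Ioi 1) (finrank ℝ E) √(1 / 2)
      have hK : K ≠ ∞ := ne_top_of_le_ne_top (by finiteness)
        (gaussMix_le_inv_pow (Ioi_subset_Ioi zero_le_one) hd (by positivity))
      have hG : ∫⁻ ξ : E, ENNReal.ofReal (rexp (-(1 / 2) * ‖ξ‖ ^ 2)) ≠ ∞ :=
        (integrable_gaussian (E := E) (by norm_num : (0 : ℝ) < 1 / 2)).lintegral_lt_top.ne
      refine ne_top_of_le_ne_top (ENNReal.mul_ne_top (a := ENNReal.ofReal (μ.real univ ^ 2) * K)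
        (by finiteness) hG) ?_
      rw [← lintegral_const_mul' _ _ (by finiteness)]
      refine (setLIntegral_mono' hm' fun ξ hξ => ?_).trans (setLIntegral_le_lintegral _ _)
      rw [mul_assoc]
      gcongr
      · linarith [sq_nonneg ‖charFun μ ξ‖]
      · exact (gaussMix_Ioi_le hξ).trans_eq (mul_comm _ _)
  rw [lintegral_sub_norm_charFun_sq_mul_gaussMix] at hfar
  intro h'
  have hc : ENNReal.ofReal (1 - rexp (-(1 / 4))) ≠ 0 := by
    rw [Ne, ENNReal.ofReal_eq_zero, not_le, sub_pos, Real.exp_lt_one_iff]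
    norm_num
  have h2 : ∫⁻ z, farKernel ‖z‖ ∂(diffMeasure μ) = ∞ := by
    rw [← top_le_iff]
    calc ∞ = ∫⁻ z, ENNReal.ofReal (1 - rexp (-(1 / 4))) * ENNReal.ofReal (log ‖z‖)
              ∂(diffMeasure μ) := by
          rw [lintegral_const_mul _ (by fun_prop), h', ENNReal.mul_top hc]
      _ ≤ _ := lintegral_mono fun z => ofReal_log_le_farKernel (norm_nonneg z)
  refine hfar ?_
  rw [h2, ENNReal.mul_top]
  simpa using rpow_pos_of_pos pi_pos _

end Moments

variable {n : ℕ}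

/-! ### Integrals against `dξ / |ξ|ⁿ` -/

lemma setLIntegral_invNormPow (s : Set (EuclideanSpace ℝ (Fin n)))
    {f : EuclideanSpace ℝ (Fin n) → ℝ≥0∞} (hf : Measurable f) :
    ∫⁻ ξ in s, f ξ ∂(invNormPow n) = ∫⁻ ξ in s, f ξ * ENNReal.ofReal (1 / ‖ξ‖ ^ n) := by
  rw [invNormPow, restrict_withDensity', lintegral_withDensity_eq_lintegral_mul _
    (by fun_prop) hf]
  simp only [Pi.mul_apply, mul_comm]

lemma invNormPow_annulus_lt_top {ε : ℝ} (hε : 0 < ε) :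
    invNormPow n {ξ | ε ≤ ‖ξ‖ ∧ ‖ξ‖ ≤ 1} < ∞ := by
  have hm : MeasurableSet {ξ : EuclideanSpace ℝ (Fin n) | ε ≤ ‖ξ‖ ∧ ‖ξ‖ ≤ 1} :=
    measurable_norm measurableSet_Icc
  have hb : volume {ξ : EuclideanSpace ℝ (Fin n) | ε ≤ ‖ξ‖ ∧ ‖ξ‖ ≤ 1} < ∞ :=
    (measure_mono fun ξ hξ => mem_closedBall_zero_iff.2 hξ.2).trans_lt
      (measure_closedBall_lt_top (x := 0) (r := 1))
  rw [← setLIntegral_one, setLIntegral_invNormPow _ measurable_const]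
  calc ∫⁻ ξ in {ξ : EuclideanSpace ℝ (Fin n) | ε ≤ ‖ξ‖ ∧ ‖ξ‖ ≤ 1},
        1 * ENNReal.ofReal (1 / ‖ξ‖ ^ n)
      ≤ ∫⁻ _ in {ξ : EuclideanSpace ℝ (Fin n) | ε ≤ ‖ξ‖ ∧ ‖ξ‖ ≤ 1},
        ENNReal.ofReal (1 / ε ^ n) := by
        refine setLIntegral_mono' hm fun ξ hξ => ?_
        rw [one_mul]
        gcongr
        exact hξ.1
    _ < ∞ := by
        rw [setLIntegral_const]
        exact ENNReal.mul_lt_top ENNReal.ofReal_lt_top hb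

/-- Since `|μ̂|² - μ(ℝⁿ)²` has constant sign, convergence of the improper integral at the origin
is absolute convergence. -/
lemma setLIntegral_punctured_ball_ne_top (μ : Measure (EuclideanSpace ℝ (Fin n)))
    [IsFiniteMeasure μ] {L : ℝ} (hlim : Tendsto
      (fun ε : ℝ => ∫ ξ in {ξ : EuclideanSpace ℝ (Fin n) | ε ≤ ‖ξ‖ ∧ ‖ξ‖ ≤ 1},
        (‖charFun μ ξ‖ ^ 2 - μ.real univ ^ 2) ∂(invNormPow n)) (𝓝[>] 0) (𝓝 L)) :
    ∫⁻ ξ in {ξ : EuclideanSpace ℝ (Fin n) | 0 < ‖ξ‖ ∧ ‖ξ‖ ≤ 1},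
      ENNReal.ofReal (μ.real univ ^ 2 - ‖charFun μ ξ‖ ^ 2) ∂(invNormPow n) ≠ ∞ := by
  set A : ℝ → Set (EuclideanSpace ℝ (Fin n)) := fun ε => {ξ | ε ≤ ‖ξ‖ ∧ ‖ξ‖ ≤ 1} with hA
  set e : ℕ → ℝ := fun k => 1 / ((k : ℝ) + 1) with he
  have he0 : ∀ k, 0 < e k := fun k => Nat.one_div_pos_of_nat
  have hmono : Monotone fun k => A (e k) := fun i j hij ξ hξ =>
    ⟨(Nat.one_div_le_one_div hij).trans hξ.1, hξ.2⟩
  have hU : {ξ : EuclideanSpace ℝ (Fin n) | 0 < ‖ξ‖ ∧ ‖ξ‖ ≤ 1} = ⋃ k, A (e k) := by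
    ext ξ
    simp only [mem_ofPred_eq, mem_iUnion, hA]
    constructor
    · rintro ⟨h0, h1⟩
      obtain ⟨k, hk⟩ := exists_nat_one_div_lt h0
      exact ⟨k, hk.le, h1⟩
    · rintro ⟨k, hk, h1⟩
      exact ⟨(he0 k).trans_le hk, h1⟩
  have heq : ∀ k, ∫⁻ ξ in A (e k), ENNReal.ofReal (μ.real univ ^ 2 - ‖charFun μ ξ‖ ^ 2)
      ∂(invNormPow n) = ENNReal.ofReal (-∫ ξ in A (e k), (‖charFun μ ξ‖ ^ 2 - μ.real univ ^ 2)
        ∂(invNormPow n)) := by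
    intro k
    rw [← integral_neg]
    simp only [neg_sub]
    refine (ofReal_integral_eq_lintegral_ofReal ?_ (ae_of_all _ fun ξ =>
      sub_nonneg.2 (norm_charFun_sq_le μ ξ))).symm
    refine Measure.integrableOn_of_bounded (M := μ.real univ ^ 2)
      (invNormPow_annulus_lt_top (he0 k)).ne (by fun_prop) (ae_of_all _ fun ξ => ?_)
    rw [Real.norm_of_nonneg (sub_nonneg.2 (norm_charFun_sq_le μ ξ))]
    linarith [sq_nonneg ‖charFun μ ξ‖]
  have he_lim : Tendsto e atTop (𝓝[>] 0) :=
    tendsto_nhdsWithin_iff.2 ⟨tendsto_one_div_add_atTop_nhds_zero_nat,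
      Eventually.of_forall he0⟩
  have h1 := ENNReal.tendsto_ofReal (hlim.comp he_lim).neg
  rw [hU, setLIntegral_iUnion_of_directed _ (directed_of_isDirected_le hmono)]
  have h2 : Tendsto (fun k => ∫⁻ ξ in A (e k),
      ENNReal.ofReal (μ.real univ ^ 2 - ‖charFun μ ξ‖ ^ 2) ∂(invNormPow n)) atTop
      (𝓝 (⨆ k, ∫⁻ ξ in A (e k),
      ENNReal.ofReal (μ.real univ ^ 2 - ‖charFun μ ξ‖ ^ 2) ∂(invNormPow n))) :=
    tendsto_atTop_iSup fun i j hij => lintegral_mono_set (hmono hij)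
  rw [tendsto_nhds_unique h2 (h1.congr fun k => (heq k).symm)]
  exact ENNReal.ofReal_ne_top

/-! ### The energy as a difference of logarithmic moments -/

/-- If `b` is integrable, then `∫ (a - b)` is finite exactly when `∫ a` is: the negative part of
`a - b` is at most `b`, and `(a - b)⁺ ≤ a ≤ (a - b)⁺ + b`. -/
lemma extIntegral_sub_ne_top_iff {α : Type*} [MeasurableSpace α] {m : Measure α}
    {a b : α → ℝ≥0∞} (hb : Measurable b) (hbm : ∫⁻ x, b x ∂m ≠ ∞) :
    (extIntegral (fun x => (a x : EReal) - (b x : EReal)) m ≠ ⊥ ∧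
      extIntegral (fun x => (a x : EReal) - (b x : EReal)) m ≠ ⊤) ↔ ∫⁻ x, a x ∂m ≠ ∞ := by
  have hbt : ∀ᵐ x ∂m, b x ≠ ∞ := (ae_lt_top hb hbm).mono fun x h => h.ne
  have hpos : ∀ x, ((a x : EReal) - (b x : EReal)).toENNReal = a x - b x := fun x => by
    rw [EReal.toENNReal_sub (EReal.coe_ennreal_nonneg _), EReal.toENNReal_coe,
      EReal.toENNReal_coe]
  have hneg : ∫⁻ x, (-((a x : EReal) - (b x : EReal))).toENNReal ∂m ≠ ∞ := by
    refine ne_top_of_le_ne_top hbm (lintegral_mono_ae (hbt.mono fun x hx => ?_))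
    rw [EReal.neg_sub (Or.inl (EReal.coe_ennreal_ne_bot _)) (Or.inr (by simpa using hx)),
      add_comm, ← sub_eq_add_neg, EReal.toENNReal_sub (EReal.coe_ennreal_nonneg _),
      EReal.toENNReal_coe, EReal.toENNReal_coe]
    exact tsub_le_self
  have hP : ∫⁻ x, (a x - b x) ∂m ≠ ∞ ↔ ∫⁻ x, a x ∂m ≠ ∞ := by
    refine ⟨fun h => ?_, fun h => ne_top_of_le_ne_top h (lintegral_mono fun x => tsub_le_self)⟩
    refine ne_top_of_le_ne_top (ENNReal.add_ne_top.2 ⟨h, hbm⟩) ?_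
    rw [← lintegral_add_right _ hb]
    exact lintegral_mono fun x => le_tsub_add
  unfold extIntegral
  simp only [hpos]
  rw [← hP]
  generalize ∫⁻ x, (-((a x : EReal) - (b x : EReal))).toENNReal ∂m = N at hneg ⊢
  lift N to NNReal using hneg
  induction ∫⁻ x, (a x - b x) ∂m with
  | top => simp
  | coe p =>
    refine iff_of_true ⟨?_, ?_⟩ ENNReal.coe_ne_top
    · exact EReal.coe_ne_bot ((p : ℝ) - (N : ℝ))
    · exact EReal.coe_ne_top ((p : ℝ) - (N : ℝ))

lemma logEnergy_finite_iff (μ : Measure (EuclideanSpace ℝ (Fin n))) [IsFiniteMeasure μ]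
    (h : ∫⁻ z, ENNReal.ofReal (log ‖z‖) ∂(diffMeasure μ) ≠ ∞) :
    (logEnergy μ ≠ ⊥ ∧ logEnergy μ ≠ ⊤) ↔ ∫⁻ z, logInvPos ‖z‖ ∂(diffMeasure μ) ≠ ∞ := by
  rw [lintegral_diffMeasure μ (by fun_prop)] at h ⊢
  have hpot : logPotential μ = fun x => ((∫⁻ y, logInvPos ‖x - y‖ ∂μ : ℝ≥0∞) : EReal) -
      ((∫⁻ y, ENNReal.ofReal (log ‖x - y‖) ∂μ : ℝ≥0∞) : EReal) := by
    ext x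
    simp only [logPotential, extIntegral, logKernel, toENNReal_neg_log_inv (norm_nonneg _),
      logInvPos]
  rw [logEnergy, hpot]
  exact extIntegral_sub_ne_top_iff (Measurable.lintegral_prod_right (by fun_prop)) h

end LogEnergy

theorem mainTheorem2 (n : ℕ) (hn : 1 ≤ n) (μ : Measure (EuclideanSpace ℝ (Fin n)))
    (hμ : LogEnergy.MemM0Plus μ)
    (hlim : ∃ L : ℝ, Tendsto
      (fun ε : ℝ => ∫ ξ in {ξ : EuclideanSpace ℝ (Fin n) | ε ≤ ‖ξ‖ ∧ ‖ξ‖ ≤ 1},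
        (‖charFun μ ξ‖ ^ 2 - μ.real Set.univ ^ 2) ∂(LogEnergy.invNormPow n))
      (𝓝[>] 0) (𝓝 L)) :
    (LogEnergy.logEnergy μ ≠ ⊥ ∧ LogEnergy.logEnergy μ ≠ ⊤) ↔
      IntegrableAtFilter (fun ξ : EuclideanSpace ℝ (Fin n) => ‖charFun μ ξ‖ ^ 2)
        (Bornology.cobounded (EuclideanSpace ℝ (Fin n))) (LogEnergy.invNormPow n) := by
  have := hμ.finite
  obtain ⟨L, hL⟩ := hlim
  have hd : Module.finrank ℝ (EuclideanSpace ℝ (Fin n)) = n := finrank_euclideanSpace_fin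
  have hd0 : 0 < Module.finrank ℝ (EuclideanSpace ℝ (Fin n)) := by omega
  have hfin := LogEnergy.setLIntegral_punctured_ball_ne_top μ hL
  rw [LogEnergy.setLIntegral_invNormPow _ (by fun_prop)] at hfin
  have hlog := LogEnergy.lintegral_log_ne_top μ hd0 (by rwa [hd])
  have htail : ∀ s : Set (EuclideanSpace ℝ (Fin n)),
      IntegrableOn (fun ξ => ‖charFun μ ξ‖ ^ 2) s (LogEnergy.invNormPow n) ↔
        ∫⁻ ξ in s, ENNReal.ofReal (‖charFun μ ξ‖ ^ 2) * ENNReal.ofReal (1 / ‖ξ‖ ^ n) ≠ ∞ := by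
    intro s
    rw [← LogEnergy.setLIntegral_invNormPow _ (by fun_prop), IntegrableOn,
      ← lintegral_ofReal_ne_top_iff_integrable (by fun_prop)
        (ae_of_all _ fun ξ => sq_nonneg _)]
  rw [LogEnergy.logEnergy_finite_iff μ hlog]
  constructor
  · intro h
    refine ⟨{ξ | 1 ≤ ‖ξ‖}, ?_, (htail _).2 ?_⟩
    · filter_upwards [tendsto_norm_cobounded_atTop.eventually_ge_atTop 1] with ξ hξ using hξ
    · have h1 := LogEnergy.setLIntegral_tail_ne_top μ hd0 h
      rwa [hd] at h1
  · rintro ⟨s, hs, hint⟩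
    refine LogEnergy.lintegral_logInvPos_ne_top_of_tail μ hd0 (s := s)
      (Bornology.isBounded_compl_iff.2 hs) ?_
    rw [hd]
    exact (htail s).1 hint
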